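/- **Setting.** Let $(X,\rho)$ be a quasi-metric space: $\rho\ge 0$, $\rho(x,y)=0$ iff $x=y$, $\rho(x,y)=\rho(y,x)$, and $\rho(x,y)\le A_0(\rho(x,z)+\rho(z,y))$ with a constant $A_0\ge 1$. Put $B(x,r)=\{y:\rho(y,x)<r\}$. Assume that, for a positive integer $A_1$, every ball $B(x,r)$, $r>0$, can be covered by at most $A_1$ balls of radius $r/2$. A set $U\subseteq X$ is open if for every $x\in U$ there is $\varepsilon>0$ with $B(x,\varepsilon)\subseteq U$; interior and closure refer to this topology, and $\operatorname{diam}Q=\sup_{y,z\in Q}\rho(y,z)$. Let $\delta\in(0,1)$ and let $\mathcal A_k$, $k\in\mathbb Z$, be index sets. *Dyadic points with constants $c_0,C_0$* are points $z_\alpha^k\in X$ ($k\in\mathbb Z$, $\alpha\in\mathcal A_k$) such that for every $k$: $\rho(z_\alpha^k,z_\beta^k)\ge c_0\delta^k$ for $\alpha\ne\beta$, and every $x\in X$ has some $\alpha$ with $\rho(x,z_\alpha^k)<C_0\delta^k$. A *dyadic order* for them is a partial order on the pairs $(k,\alpha)$ in which each $(k+1,\beta)$ has exactly one parent $(k,\alpha)\ge(k+1,\beta)$,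 where $\rho(z_\beta^{k+1},z_\alpha^k)<(2A_0)^{-1}c_0\delta^k$ implies $(k+1,\beta)\le(k,\alpha)$, where $(k+1,\beta)\le(k,\alpha)$ implies $\rho(z_\beta^{k+1},z_\alpha^k)<C_0\delta^k$, and which is the reflexive-transitive closure of the parent relation. Given dyadic points and a dyadic order, the closed cube $\bar Q_\alpha^k$ is the closure of $\{z_\beta^\ell:(\ell,\beta)\le(k,\alpha)\}$, and the open cube is $\tilde Q_\alpha^k=X\setminus\bigcup_{\beta\ne\alpha}\bar Q_\beta^k$. A *dyadic system* related to the dyadic points is a family of sets $Q_\alpha^k$ for which there is a dyadic order such that, with $c_1=(3A_0^2)^{-1}c_0$ and $C_1=2A_0C_0$, 1. $\tilde Q_\alpha^k\subseteq Q_\alpha^k\subseteq\bar Q_\alpha^k$, and $\tilde Q_\alpha^k$, $\bar Q_\alpha^k$ are the interior and the closure of $Q_\alpha^k$; 2. if $\ell\ge k$, then either $Q_\beta^\ell\subseteq Q_\alpha^k$ or $Q_\alpha^k\cap Q_\beta^\ell=\emptyset$; 3. $X=\bigcup_{\alpha}Q_\alpha^k$ is a disjoint union for every $k$; 4. $B(z_\alpha^k,c_1\delta^k)\subseteq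 Q_\alpha^k\subseteq B(z_\alpha^k,C_1\delta^k)$; 5. if $k\le\ell$ and $Q_\beta^\ell\subseteq Q_\alpha^k$, then $B(z_\beta^\ell,C_1\delta^\ell)\subseteq B(z_\alpha^k,C_1\delta^k)$. **Theorem 6.1.** Suppose that $\delta\in(0,1)$ and $144A_0^8\delta\le1$. There are a constant $C=C(A_0,\delta)<\infty$, a positive integer $K=K(A_0,A_1,\delta)$ and a number $\tau_0=\tau_0(A_0,A_1,\delta)>0$ with the following property. Let $\{x_\alpha^k\}$ (the reference points) be dyadic points with constants $c_0=C_0=1$, with a fixed dyadic order $\le$. Then there are a probability space $(\Omega,\mathbb P)$ and, for every $\omega\in\Omega$ and $t\in\{1,\dots,K\}$, new dyadic points $\{{}^tz_\alpha^k(\omega)\}_{k\in\mathbb Z,\,\alpha\in\mathcal A_k}$ with constants $c_0=(4A_0^2)^{-1}$ and $C_0=2A_0$ and a dyadic system $\mathcal D^t(\omega)=\{{}^tQ_\alpha^k(\omega)\}_{k,\alpha}$ related to them, that is, with properties 1–5, such that: * for every $\omega\in\Omega$ and every ball $B=B(x,r)$, $x\in X$, $r>0$, there are $t\in\{1,\dots,K\}$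 and $Q\in\mathcal D^t(\omega)$ with $B\subseteq Q$ and $\operatorname{diam}(Q)\le Cr$; * $\Omega=\prod_{k\in\mathbb Z}\Omega_k$ with the product $\sigma$-algebra, and the coordinates $\omega_k\in\Omega_k$ of $\omega=(\omega_k)_{k\in\mathbb Z}$ are independent under $\mathbb P$; * for every $t$, $k$ and $\alpha$, the point ${}^tz_\alpha^k(\omega)={}^tz_\alpha^k(\omega_k)$ depends on the coordinate $\omega_k$ only, and $\{\omega:{}^tz_\alpha^k(\omega)=y\}$ is an event for every $y\in X$; * for every $t$, if $(k+1,\beta)\le(k,\alpha)$, then $\mathbb P(\{\omega\in\Omega:{}^tz_\alpha^k(\omega)=x_\beta^{k+1}\})\ge\tau_0$. -/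

import Mathlib

open MeasureTheory ProbabilityTheory

universe u v

/-- `ρ` is a quasi-metric on `X` with quasi-metric constant `A₀ ≥ 1`. -/
structure IsQuasiMetric {X : Type u} (ρ : X → X → ℝ) (A₀ : ℝ) : Prop where
  one_le : 1 ≤ A₀
  nonneg : ∀ x y, 0 ≤ ρ x y
  eq_zero_iff : ∀ x y, ρ x y = 0 ↔ x = y
  symm : ∀ x y, ρ x y = ρ y x
  triangle : ∀ x y z, ρ x y ≤ A₀ * (ρ x z + ρ z y)

/-- The ball `B(x, r) = {y : ρ(y, x) < r}`. -/
def qBall {X : Type u} (ρ : X → X → ℝ) (x : X) (r : ℝ) : Set X := {y | ρ y x < r}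

/-- Geometric doubling: every ball `B(x, r)` is covered by at most `A₁` balls of radius `r / 2`. -/
def GeometricallyDoubling {X : Type u} (ρ : X → X → ℝ) (A₁ : ℕ) : Prop :=
  ∀ (x : X) (r : ℝ), 0 < r →
    ∃ s : Finset X, s.card ≤ A₁ ∧ qBall ρ x r ⊆ ⋃ y ∈ s, qBall ρ y (r / 2)

/-- The topology of a quasi-metric: `U` is open if every point of `U` is the centre of a ball of
positive radius contained in `U`. (The balls themselves need not be open.) -/
@[reducible] def qTopology {X : Type u} (ρ : X → X → ℝ) : TopologicalSpace X where
  IsOpen U := ∀ x ∈ U, ∃ ε : ℝ, 0 < ε ∧ qBall ρ x ε ⊆ U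
  isOpen_univ := fun _ _ => ⟨1, one_pos, Set.subset_univ _⟩
  isOpen_inter := by
    intro U V hU hV x hx
    obtain ⟨a, ha, haU⟩ := hU x hx.1
    obtain ⟨b, hb, hbV⟩ := hV x hx.2
    exact ⟨min a b, lt_min ha hb, fun y hy =>
      ⟨haU (lt_of_lt_of_le hy (min_le_left a b)), hbV (lt_of_lt_of_le hy (min_le_right a b))⟩⟩
  isOpen_sUnion := by
    intro S hS x hx
    obtain ⟨U, hUS, hxU⟩ := hx
    obtain ⟨ε, hε, h⟩ := hS U hUS x hxU
    exact ⟨ε, hε, fun y hy => ⟨U, hUS, h hy⟩⟩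

/-- The diameter `sup {ρ(y, z) : y, z ∈ S}`, as an extended nonnegative number. -/
noncomputable def qDiam {X : Type u} (ρ : X → X → ℝ) (S : Set X) : ENNReal :=
  ⨆ y ∈ S, ⨆ z ∈ S, ENNReal.ofReal (ρ y z)

/-- The distribution property of a family of dyadic points `z k α`, where `k : ℤ` is the
generation and `α` ranges over the index set `A k`: the points of generation `k` are
`c₀ δ ^ k`-separated, and every point of the space is at distance less than `C₀ δ ^ k` from one of
them. -/
structure IsDyadicPoints {X : Type u} (ρ : X → X → ℝ) (c₀ C₀ δ : ℝ) {A : ℤ → Type v}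
    (z : ∀ k, A k → X) : Prop where
  separated : ∀ k (α β : A k), α ≠ β → c₀ * δ ^ k ≤ ρ (z k α) (z k β)
  dense : ∀ k (y : X), ∃ α : A k, ρ y (z k α) < C₀ * δ ^ k

/-- `par` is an admissible choice of parents for the dyadic points `z`: each `(k + 1, β)` has
exactly one parent `(k, par k β)`; a point of generation `k` at distance less than
`c₀ δ ^ k / (2 A₀)` is the parent; and the parent is at distance less than `C₀ δ ^ k`.
Thus `par k β = α` means that `(k + 1, β)` is a child of `(k, α)`. -/
structure IsParentMap {X : Type u} (ρ : X → X → ℝ) (A₀ c₀ C₀ δ : ℝ) {A : ℤ → Type v}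
    (z : ∀ k, A k → X) (par : ∀ k, A (k + 1) → A k) : Prop where
  near : ∀ k (β : A (k + 1)) (α : A k),
    ρ (z (k + 1) β) (z k α) < (2 * A₀)⁻¹ * c₀ * δ ^ k → par k β = α
  dist_lt : ∀ k (β : A (k + 1)), ρ (z (k + 1) β) (z k (par k β)) < C₀ * δ ^ k

/-- The partial order `(ℓ, β) ≤ (k, α)` among index pairs, the reflexive and transitive closure of
the relation "is a child of": `(ℓ, β)` is a descendant of `(k, α)`. -/
def DyadicLE {A : ℤ → Type v} (par : ∀ k, A (k + 1) → A k) : (Σ k, A k) → (Σ k, A k) → Prop :=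
  Relation.ReflTransGen fun p q =>
    ∃ (k : ℤ) (β : A (k + 1)), p = ⟨k + 1, β⟩ ∧ q = ⟨k, par k β⟩

/-- The preliminary dyadic cube: all the points `z ℓ β` with `(ℓ, β) ≤ (k, α)`. -/
def preCube {X : Type u} {A : ℤ → Type v} (z : ∀ k, A k → X) (par : ∀ k, A (k + 1) → A k)
    (k : ℤ) (α : A k) : Set X :=
  {y | ∃ (ℓ : ℤ) (β : A ℓ), DyadicLE par ⟨ℓ, β⟩ ⟨k, α⟩ ∧ z ℓ β = y}

/-- The closed dyadic cube: the closure of the preliminary cube. -/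
def closedCube {X : Type u} (ρ : X → X → ℝ) {A : ℤ → Type v} (z : ∀ k, A k → X)
    (par : ∀ k, A (k + 1) → A k) (k : ℤ) (α : A k) : Set X :=
  @closure X (qTopology ρ) (preCube z par k α)

/-- The open dyadic cube: the complement of the union of all the other closed cubes of the same
generation. -/
def openCube {X : Type u} (ρ : X → X → ℝ) {A : ℤ → Type v} (z : ∀ k, A k → X)
    (par : ∀ k, A (k + 1) → A k) (k : ℤ) (α : A k) : Set X :=
  (⋃ (β : A k) (_ : β ≠ α), closedCube ρ z par k β)ᶜ

/-- `Q` is a system of (half-open) dyadic cubes related to the dyadic points `z` (with distribution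
constants `c₀`, `C₀`) and the parents `par`. Here `c₁ = (3 A₀²)⁻¹ c₀` and `C₁ = 2 A₀ C₀`, and
`B(z k α, C₁ δ ^ k)` is the containing ball of `Q k α`. -/
structure IsDyadicSystem {X : Type u} (ρ : X → X → ℝ) (A₀ c₀ C₀ δ : ℝ) {A : ℤ → Type v}
    (z : ∀ k, A k → X) (par : ∀ k, A (k + 1) → A k) (Q : ∀ k, A k → Set X) : Prop where
  points : IsDyadicPoints ρ c₀ C₀ δ z
  parents : IsParentMap ρ A₀ c₀ C₀ δ z par
  open_subset : ∀ k α, openCube ρ z par k α ⊆ Q k α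
  subset_closed : ∀ k α, Q k α ⊆ closedCube ρ z par k α
  interior_eq : ∀ k α, openCube ρ z par k α = @interior X (qTopology ρ) (Q k α)
  closure_eq : ∀ k α, closedCube ρ z par k α = @closure X (qTopology ρ) (Q k α)
  nested : ∀ k ℓ (α : A k) (β : A ℓ), k ≤ ℓ → Q ℓ β ⊆ Q k α ∨ Q k α ∩ Q ℓ β = ∅
  cover : ∀ k, ⋃ α, Q k α = Set.univ
  disjoint : ∀ k (α β : A k), α ≠ β → Disjoint (Q k α) (Q k β)
  ball_subset : ∀ k α, qBall ρ (z k α) ((3 * A₀ ^ 2)⁻¹ * c₀ * δ ^ k) ⊆ Q k α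
  subset_ball : ∀ k α, Q k α ⊆ qBall ρ (z k α) (2 * A₀ * C₀ * δ ^ k)
  ball_mono : ∀ k ℓ (α : A k) (β : A ℓ), k ≤ ℓ → Q ℓ β ⊆ Q k α →
    qBall ρ (z ℓ β) (2 * A₀ * C₀ * δ ^ ℓ) ⊆ qBall ρ (z k α) (2 * A₀ * C₀ * δ ^ k)

/-! Colour the reference points of generation `k + 1` with boundedly many colours so that points of
one colour are `2 * A₀ * δ ^ k` apart. Siblings then have different colours. Given a colour for each
generation, move each reference point to its child of that colour, if there is one, and otherwise
leave it. Separation survives: two moved points share a colour, and a moved point is not too close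
to an unmoved one because it is not its child (`IsParentMap.isDyadicPoints_of_children`). For small
`δ` any dyadic points carry half-open cubes (`IsParentMap.exists_isDyadicSystem`).

The coordinate `ω k` is a uniform random colour, and system `t` uses the colour `ω k + t`. For fixed
`ω`, as `t` varies every child becomes a cube centre. A ball of radius about `δ ^ (k + 1)` is close
to some reference point of generation `k + 1`; in the system where that point is a centre of
generation `k`, the inner ball of its cube contains the given ball. -/

/-! ### Topology and doubling in quasi-metric spaces -/

section QuasiMetric

variable {X : Type u} {ρ : X → X → ℝ} {A₀ : ℝ}

theorem IsQuasiMetric.pos (h : IsQuasiMetric ρ A₀) : 0 < A₀ := one_pos.trans_le h.one_le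

theorem IsQuasiMetric.self_eq_zero (h : IsQuasiMetric ρ A₀) (x : X) : ρ x x = 0 :=
  (h.eq_zero_iff x x).2 rfl

theorem IsQuasiMetric.mem_qBall_self (h : IsQuasiMetric ρ A₀) (x : X) {r : ℝ} (hr : 0 < r) :
    x ∈ qBall ρ x r := by
  simpa [qBall, h.self_eq_zero x] using hr

/-- The triangle inequality for strict upper bounds. -/
theorem IsQuasiMetric.lt_of_lt (h : IsQuasiMetric ρ A₀) {x y z : X} {a b c : ℝ}
    (hxz : ρ x z < a) (hzy : ρ z y < b) (hc : A₀ * (a + b) ≤ c) : ρ x y < c :=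
  (h.triangle x y z).trans_lt
    ((mul_lt_mul_of_pos_left (add_lt_add hxz hzy) h.pos).trans_le hc)

/-- Balls need not be open, but the set of points having some ball inside `U` is, since a ball of
radius `η` contains all balls of radius `η / (2 * A₀)` centred within `η / (2 * A₀)` of its centre.
-/
theorem IsQuasiMetric.nhds_hasBasis (h : IsQuasiMetric ρ A₀) (x : X) :
    (@nhds X (qTopology ρ) x).HasBasis (fun ε : ℝ => 0 < ε) (qBall ρ x) := by
  let _ := qTopology ρ
  refine ⟨fun U => ?_⟩
  rw [mem_nhds_iff]
  constructor
  · rintro ⟨V, hVU, hV, hx⟩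
    obtain ⟨ε, hε, hb⟩ := hV x hx
    exact ⟨ε, hε, hb.trans hVU⟩
  · rintro ⟨ε, hε, hb⟩
    refine ⟨{y | ∃ ε : ℝ, 0 < ε ∧ qBall ρ y ε ⊆ U}, ?_, ?_, ε, hε, hb⟩
    · rintro y ⟨η, hη, hy⟩
      exact hy (h.mem_qBall_self y hη)
    · rintro y ⟨η, hη, hy⟩
      have hη' : 0 < η / (2 * A₀) := div_pos hη (by linarith [h.pos])
      refine ⟨η / (2 * A₀), hη', fun w hw => ⟨η / (2 * A₀), hη', fun v hv => hy ?_⟩⟩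
      refine h.lt_of_lt hv hw (le_of_eq ?_)
      have := h.pos.ne'
      field_simp
      ring

theorem IsQuasiMetric.mem_closure_iff (h : IsQuasiMetric ρ A₀) {S : Set X} {y : X} :
    y ∈ @closure X (qTopology ρ) S ↔ ∀ ε : ℝ, 0 < ε → ∃ s ∈ S, ρ s y < ε := by
  let _ := qTopology ρ
  exact mem_closure_iff_nhds_basis (h.nhds_hasBasis y)

theorem GeometricallyDoubling.exists_cover_pow {A₁ : ℕ} (h : GeometricallyDoubling ρ A₁)
    (m : ℕ) (x : X) {r : ℝ} (hr : 0 < r) :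
    ∃ s : Finset X, s.card ≤ A₁ ^ m ∧ qBall ρ x r ⊆ ⋃ y ∈ s, qBall ρ y (r / 2 ^ m) := by
  classical
  induction m with
  | zero => exact ⟨{x}, by simp, by simp⟩
  | succ m ih =>
    obtain ⟨s, hs, hsub⟩ := ih
    choose t ht htsub using fun y : X => h y (r / 2 ^ m) (by positivity)
    refine ⟨s.biUnion t, ?_, fun w hw => ?_⟩
    · calc (s.biUnion t).card ≤ s.card * A₁ := Finset.card_biUnion_le_card_mul _ _ _ fun y _ => ht y
        _ ≤ A₁ ^ (m + 1) := by rw [pow_succ]; exact Nat.mul_le_mul_right _ hs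
    · obtain ⟨y, hy, hwy⟩ := Set.mem_iUnion₂.1 (hsub hw)
      obtain ⟨v, hv, hwv⟩ := Set.mem_iUnion₂.1 (htsub y hwy)
      refine Set.mem_iUnion₂.2 ⟨v, Finset.mem_biUnion.2 ⟨y, hy, hv⟩, ?_⟩
      rwa [div_div, ← pow_succ] at hwv

/-- In a geometrically doubling space, a ball contains boundedly many points of a separated
family. -/
theorem GeometricallyDoubling.finite_and_ncard_le {A₁ : ℕ} (h : GeometricallyDoubling ρ A₁)
    (hρ : IsQuasiMetric ρ A₀) {ι : Type*} (f : ι → X) {c R : ℝ} (hR : 0 < R) {m : ℕ}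
    (hm : 2 * A₀ * R ≤ c * 2 ^ m) (hf : ∀ i j, i ≠ j → c ≤ ρ (f i) (f j)) (x : X) :
    {i | ρ (f i) x < R}.Finite ∧ {i | ρ (f i) x < R}.ncard ≤ A₁ ^ m := by
  obtain ⟨s, hs, hsub⟩ := h.exists_cover_pow m x hR
  have hex : ∀ i, ρ (f i) x < R → ∃ y ∈ s, ρ (f i) y < R / 2 ^ m := fun i hi => by
    simpa [qBall] using hsub hi
  have : ∀ i, ∃ y, ρ (f i) x < R → y ∈ s ∧ ρ (f i) y < R / 2 ^ m := fun i => by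
    by_cases hi : ρ (f i) x < R
    · obtain ⟨y, hy⟩ := hex i hi
      exact ⟨y, fun _ => hy⟩
    · exact ⟨f i, fun hi' => absurd hi' hi⟩
  choose g hg using this
  have hmaps : Set.MapsTo g {i | ρ (f i) x < R} s := fun i hi => (hg i hi).1
  have hinj : Set.InjOn g {i | ρ (f i) x < R} := by
    intro i hi j hj hij
    by_contra hne
    refine (hf i j hne).not_gt (hρ.lt_of_lt (b := R / 2 ^ m) (hg i hi).2 ?_ ?_)
    · rw [hij, hρ.symm]
      exact (hg j hj).2
    · rw [← add_div, ← mul_div_assoc, div_le_iff₀ (by positivity)]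
      linarith
  refine ⟨Set.Finite.of_injOn hmaps hinj s.finite_toSet, ?_⟩
  refine (Set.ncard_le_ncard_of_injOn g hmaps hinj s.finite_toSet).trans ?_
  rwa [Set.ncard_coe_finset]

end QuasiMetric

/-- Greedy colouring: if every point has at most `N` neighbours, then `N + 1` colours suffice. -/
theorem exists_coloring_of_ncard_le {ι : Type*} (r : ι → ι → Prop) (hr : ∀ i j, r i j → r j i)
    (N : ℕ) (hfin : ∀ i, {j | r i j}.Finite) (hN : ∀ i, {j | r i j}.ncard ≤ N) :
    ∃ c : ι → Fin (N + 1), ∀ i j, i ≠ j → r i j → c i ≠ c j := by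
  classical
  have step : ∀ (i : ι) (c : ∀ j, WellOrderingRel j i → Fin (N + 1)),
      ∃ a : Fin (N + 1), ∀ j (hj : WellOrderingRel j i), r i j → a ≠ c j hj := by
    intro i c
    -- The junk colour of later neighbours is harmless: all neighbours together still use at most
    -- `N` colours.
    let c' : ι → Fin (N + 1) := fun j => if hj : WellOrderingRel j i then c j hj else 0
    have hcard : ((hfin i).toFinset.image c').card < Fintype.card (Fin (N + 1)) := by
      refine Finset.card_image_le.trans_lt ?_
      rw [← Set.ncard_eq_toFinset_card _ (hfin i), Fintype.card_fin]
      exact Nat.lt_succ_of_le (hN i)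
    obtain ⟨a, ha⟩ : ∃ a, a ∉ (hfin i).toFinset.image c' := by
      by_contra! hall
      exact hcard.ne (by rw [Finset.eq_univ_of_forall hall, Finset.card_univ])
    refine ⟨a, fun j hj hij hac => ha (Finset.mem_image.2 ⟨j, by simpa using hij, ?_⟩)⟩
    simp [c', hj, hac]
  choose g hg using step
  let c : ι → Fin (N + 1) := IsWellFounded.fix WellOrderingRel g
  have hc : ∀ i j, WellOrderingRel j i → r i j → c i ≠ c j := by
    intro i j hj hij
    have := hg i (fun j _ => c j) j hj hij
    rwa [← IsWellFounded.fix_eq WellOrderingRel g i] at this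
  refine ⟨c, fun i j hne hij => ?_⟩
  rcases trichotomous_of WellOrderingRel i j with h | h | h
  · exact (hc j i h (hr i j hij)).symm
  · exact absurd h hne
  · exact hc i j h hij

/-! ### Ancestors and descendants -/

section Order

variable {A : ℤ → Type v} {par : ∀ k, A (k + 1) → A k}

theorem DyadicLE.level_le {p q : Σ k, A k} (h : DyadicLE par p q) : q.1 ≤ p.1 := by
  induction h with
  | refl => exact le_rfl
  | tail _ hbc ih =>
    obtain ⟨k, β, rfl, rfl⟩ := hbc
    exact (Int.le_add_one le_rfl).trans ih

theorem DyadicLE.parent {p : Σ k, A k} {k : ℤ} {β : A (k + 1)}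
    (h : DyadicLE par p ⟨k + 1, β⟩) : DyadicLE par p ⟨k, par k β⟩ :=
  h.tail ⟨k, β, rfl, rfl⟩

theorem DyadicLE.eq_or_exists_child {p : Σ k, A k} {k : ℤ} {α : A k}
    (h : DyadicLE par p ⟨k, α⟩) :
    p = ⟨k, α⟩ ∨ ∃ β, par k β = α ∧ DyadicLE par p ⟨k + 1, β⟩ := by
  rcases Relation.ReflTransGen.cases_tail h with h | ⟨q, hq, k', β, rfl, hβ⟩
  · exact Or.inl h.symm
  · cases hβ
    exact Or.inr ⟨β, rfl, hq⟩

theorem dyadicLE_eq_of_level_eq {k : ℤ} {α β : A k} (h : DyadicLE par ⟨k, α⟩ ⟨k, β⟩) :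
    α = β := by
  rcases h.eq_or_exists_child with h | ⟨γ, -, hγ⟩
  · cases h; rfl
  · have : k + 1 ≤ k := hγ.level_le
    omega

/-- Parents are unique, so the ancestors of `p` form a chain, which meets each level at most once.
-/
theorem DyadicLE.eq_of_le {p : Σ k, A k} {k : ℤ} {α β : A k} (hα : DyadicLE par p ⟨k, α⟩)
    (hβ : DyadicLE par p ⟨k, β⟩) : α = β := by
  have hU : Relator.RightUnique fun p q : Σ k, A k =>
      ∃ (k : ℤ) (β : A (k + 1)), p = ⟨k + 1, β⟩ ∧ q = ⟨k, par k β⟩ := by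
    rintro p q q' ⟨k, β, rfl, rfl⟩ ⟨k', β', hp, rfl⟩
    obtain rfl : k = k' := by
      have := congrArg Sigma.fst hp
      simpa using this
    cases hp
    rfl
  rcases Relation.ReflTransGen.total_of_right_unique hU hα hβ with h | h
  · exact dyadicLE_eq_of_level_eq h
  · exact (dyadicLE_eq_of_level_eq h).symm

theorem exists_dyadicLE (par : ∀ k, A (k + 1) → A k) {k ℓ : ℤ} (h : k ≤ ℓ) (β : A ℓ) :
    ∃ α : A k, DyadicLE par ⟨ℓ, β⟩ ⟨k, α⟩ := by
  induction ℓ, h using Int.leInduction with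
  | base => exact ⟨β, Relation.ReflTransGen.refl⟩
  | succ ℓ _ ih =>
    obtain ⟨α, hα⟩ := ih (par ℓ β)
    exact ⟨α, Relation.ReflTransGen.head ⟨ℓ, β, rfl, rfl⟩ hα⟩

end Order

/-! ### Parents and distance estimates -/

section Points

variable {X : Type u} {ρ : X → X → ℝ} {A₀ c₀ C₀ δ : ℝ} {A : ℤ → Type v} {z : ∀ k, A k → X}
  {par : ∀ k, A (k + 1) → A k}

/-- Any dyadic points admit a choice of parents. -/
theorem IsDyadicPoints.exists_isParentMap (hρ : IsQuasiMetric ρ A₀) (hδ : 0 < δ) (hc : 0 < c₀)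
    (hcC : c₀ ≤ C₀) (hz : IsDyadicPoints ρ c₀ C₀ δ z) :
    ∃ par : ∀ k, A (k + 1) → A k, IsParentMap ρ A₀ c₀ C₀ δ z par := by
  have hA := hρ.pos
  have key : ∀ k (β : A (k + 1)), ∃ α : A k, ρ (z (k + 1) β) (z k α) < C₀ * δ ^ k ∧
      ∀ α', ρ (z (k + 1) β) (z k α') < (2 * A₀)⁻¹ * c₀ * δ ^ k → α = α' := by
    intro k β
    have hk : 0 < δ ^ k := zpow_pos hδ k
    by_cases h : ∃ α, ρ (z (k + 1) β) (z k α) < (2 * A₀)⁻¹ * c₀ * δ ^ k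
    · obtain ⟨α, hα⟩ := h
      refine ⟨α, hα.trans_le ?_, fun α' hα' => ?_⟩
      · have : (2 * A₀)⁻¹ ≤ 1 := inv_le_one_of_one_le₀ (by linarith [hρ.one_le])
        gcongr
        nlinarith
      · by_contra hne
        refine (hz.separated k α α' hne).not_gt (hρ.lt_of_lt (a := (2 * A₀)⁻¹ * c₀ * δ ^ k)
          (z := z (k + 1) β) ?_ hα' ?_)
        · rwa [hρ.symm]
        · refine le_of_eq ?_
          field_simp
          ring
    · obtain ⟨α, hα⟩ := hz.dense k (z (k + 1) β)
      exact ⟨α, hα, fun α' hα' => absurd ⟨α', hα'⟩ h⟩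
  choose par hpar using key
  exact ⟨par, fun k β α h => (hpar k β).2 α h, fun k β => (hpar k β).1⟩

/-- A descendant is close to its ancestor. -/
theorem IsParentMap.dist_lt_of_dyadicLE (hρ : IsQuasiMetric ρ A₀) (hδ : 0 < δ) (hC : 0 < C₀)
    (hAδ : 2 * A₀ * δ ≤ 1) (hp : IsParentMap ρ A₀ c₀ C₀ δ z par) {p q : Σ k, A k}
    (h : DyadicLE par p q) : ρ (z p.1 p.2) (z q.1 q.2) < 2 * A₀ * C₀ * δ ^ q.1 := by
  have hA := hρ.pos
  induction h with
  | refl => rw [hρ.self_eq_zero]; positivity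
  | tail _ hbc ih =>
    obtain ⟨k, β, rfl, rfl⟩ := hbc
    refine hρ.lt_of_lt ih (hp.dist_lt k β) ?_
    dsimp only
    have hk : 0 < C₀ * δ ^ k := by positivity
    rw [zpow_add_one₀ hδ.ne']
    nlinarith [mul_le_mul_of_nonneg_left hAδ (mul_pos hA hk).le]

/-- Points of a closed cube are close to its centre. -/
theorem IsParentMap.dist_lt_of_mem_closedCube (hρ : IsQuasiMetric ρ A₀) (hδ : 0 < δ)
    (hC : 0 < C₀) (hAδ : 4 * A₀ ^ 2 * δ ≤ 1) (hp : IsParentMap ρ A₀ c₀ C₀ δ z par) {k : ℤ}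
    {α : A k} {y : X} (hy : y ∈ closedCube ρ z par k α) :
    ρ y (z k α) < 2 * A₀ * C₀ * δ ^ k := by
  have hA := hρ.pos
  have hA1 := hρ.one_le
  have hk : 0 < C₀ * δ ^ k := by positivity
  have hAδ' : 2 * A₀ * δ ≤ 1 := by nlinarith [mul_pos hA hδ]
  -- This radius matches the bound for descendants of a child, so the approximation error is
  -- absorbed by `4 * A₀ ^ 2 * δ ≤ 1`.
  obtain ⟨_, ⟨ℓ, γ, hγ, rfl⟩, hd⟩ := hρ.mem_closure_iff.1 hy (2 * A₀ * C₀ * δ ^ (k + 1))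
    (by positivity)
  rw [hρ.symm] at hd
  rw [zpow_add_one₀ hδ.ne'] at hd
  rcases hγ.eq_or_exists_child with h | ⟨σ, rfl, hσ⟩
  · cases h
    refine hd.trans_le ?_
    have hδ1 : δ ≤ 1 := by nlinarith
    nlinarith [mul_le_mul_of_nonneg_left hδ1 (mul_pos hA hk).le]
  · have h1 := hp.dist_lt_of_dyadicLE hρ hδ hC hAδ' hσ
    dsimp only at h1
    rw [zpow_add_one₀ hδ.ne'] at h1
    refine hρ.lt_of_lt (hρ.lt_of_lt hd h1 le_rfl) (hp.dist_lt k σ) ?_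
    nlinarith [mul_le_mul_of_nonneg_left hAδ (mul_pos hA hk).le]

end Points

/-! ### Construction of half-open cubes -/

section Cubes

variable {X : Type u} {ρ : X → X → ℝ} {A₀ c₀ C₀ δ : ℝ} {A : ℤ → Type v} {z : ∀ k, A k → X}
  {par : ∀ k, A (k + 1) → A k} {A₁ : ℕ}

theorem IsDyadicPoints.finite_near (hz : IsDyadicPoints ρ c₀ C₀ δ z) (hρ : IsQuasiMetric ρ A₀)
    (hd : GeometricallyDoubling ρ A₁) (hδ : 0 < δ) (hc : 0 < c₀) (k : ℤ) (y : X) (R : ℝ) :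
    {α : A k | ρ (z k α) y < R}.Finite := by
  rcases le_or_gt R 0 with hR | hR
  · convert Set.finite_empty
    ext α
    simpa using hR.trans (hρ.nonneg _ _)
  · have hk : 0 < c₀ * δ ^ k := by positivity
    obtain ⟨m, hm⟩ := pow_unbounded_of_one_lt (2 * A₀ * R / (c₀ * δ ^ k)) one_lt_two
    refine (hd.finite_and_ncard_le hρ (z k) hR (m := m) ?_ (hz.separated k) y).1
    rw [div_lt_iff₀ hk] at hm
    linarith

/-- Every point lies in all the closed cubes of a bi-infinite chain of descendants. -/
theorem IsParentMap.exists_chain (hp : IsParentMap ρ A₀ c₀ C₀ δ z par)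
    (hz : IsDyadicPoints ρ c₀ C₀ δ z) (hρ : IsQuasiMetric ρ A₀)
    (hd : GeometricallyDoubling ρ A₁) (hδ : 0 < δ) (hδ1 : δ < 1) (hc : 0 < c₀) (hC : 0 < C₀)
    (hAδ : 2 * A₀ * δ ≤ 1) (y : X) :
    ∃ a : ∀ k, A k, (∀ k, par k (a (k + 1)) = a k) ∧ ∀ k, y ∈ closedCube ρ z par k (a k) := by
  choose b hb using fun n : ℕ => hz.dense n y
  -- The ultrafilter replaces a diagonal argument: at each level it picks one of finitely many
  -- possible ancestors of the approximants `b n`, compatibly across levels.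
  let U : Ultrafilter ℕ := Filter.hyperfilter ℕ
  have hU : (U : Filter ℕ) ≤ Filter.atTop := by
    rw [← Nat.cofinite_eq_atTop]
    exact Filter.hyperfilter_le_cofinite
  have key : ∀ k : ℤ, ∃ α : A k, ∀ᶠ n : ℕ in (U : Filter ℕ), DyadicLE par ⟨n, b n⟩ ⟨k, α⟩ := by
    intro k
    have hfin := hz.finite_near hρ hd hδ hc k y
      (A₀ * (2 * A₀ * C₀ * δ ^ k + C₀ * δ ^ k))
    have hev : ∀ᶠ n : ℕ in (U : Filter ℕ),
        ∃ α ∈ {α : A k | ρ (z k α) y < A₀ * (2 * A₀ * C₀ * δ ^ k + C₀ * δ ^ k)},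
          DyadicLE par ⟨n, b n⟩ ⟨k, α⟩ := by
      filter_upwards [hU (Filter.eventually_ge_atTop k.toNat)] with n hn
      have hkn : k ≤ n := Int.toNat_le.1 hn
      obtain ⟨α, hα⟩ := exists_dyadicLE par hkn (b n)
      refine ⟨α, hρ.lt_of_lt (z := z n (b n)) ?_ ?_ le_rfl, hα⟩
      · rw [hρ.symm]
        exact hp.dist_lt_of_dyadicLE hρ hδ hC hAδ hα
      · rw [hρ.symm]
        refine (hb n).trans_le (mul_le_mul_of_nonneg_left ?_ hC.le)
        exact zpow_le_zpow_right_of_le_one₀ hδ hδ1.le hkn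
    obtain ⟨α, -, hα⟩ := (Ultrafilter.eventually_exists_mem_iff hfin).1 hev
    exact ⟨α, hα⟩
  choose a ha using key
  refine ⟨a, fun k => ?_, fun k => hρ.mem_closure_iff.2 fun ε hε => ?_⟩
  · obtain ⟨n, hn, hn'⟩ := ((ha (k + 1)).and (ha k)).exists
    exact hn.parent.eq_of_le hn'
  · have hlim : Filter.Tendsto (fun n : ℕ => C₀ * δ ^ n) Filter.atTop (nhds 0) := by
      simpa using (tendsto_pow_atTop_nhds_zero_of_lt_one hδ.le hδ1).const_mul C₀
    obtain ⟨n, hn, hn'⟩ := ((ha k).and (hU (hlim.eventually_lt_const hε))).exists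
    refine ⟨_, ⟨n, b n, hn, rfl⟩, ?_⟩
    rw [hρ.symm]
    refine (hb n).trans ?_
    rw [zpow_natCast]
    exact hn'

/-- The open cubes are open. -/
theorem IsParentMap.isOpen_openCube (hp : IsParentMap ρ A₀ c₀ C₀ δ z par)
    (hz : IsDyadicPoints ρ c₀ C₀ δ z) (hρ : IsQuasiMetric ρ A₀)
    (hd : GeometricallyDoubling ρ A₁) (hδ : 0 < δ) (hc : 0 < c₀) (hC : 0 < C₀)
    (hAδ : 4 * A₀ ^ 2 * δ ≤ 1) (k : ℤ) (α : A k) :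
    @IsOpen X (qTopology ρ) (openCube ρ z par k α) := by
  let _ := qTopology ρ
  have hlf : LocallyFinite fun β : A k => closedCube ρ z par k β := by
    intro y
    refine ⟨qBall ρ y 1, (hρ.nhds_hasBasis y).mem_of_mem one_pos,
      (hz.finite_near hρ hd hδ hc k y (A₀ * (2 * A₀ * C₀ * δ ^ k + 1))).subset ?_⟩
    rintro β ⟨w, hw, hwy⟩
    refine hρ.lt_of_lt (z := w) ?_ hwy le_rfl
    rw [hρ.symm]
    exact hp.dist_lt_of_mem_closedCube hρ hδ hC hAδ hw
  have hlf' := hlf.comp_injective (Subtype.val_injective (p := fun β : A k => β ≠ α))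
  have : IsClosed (⋃ β : {β : A k // β ≠ α}, closedCube ρ z par k β.1) :=
    hlf'.isClosed_iUnion fun β => isClosed_closure
  rw [Set.iUnion_subtype] at this
  exact this.isOpen_compl

/-- Dyadic points with a choice of parents have a dyadic system of half-open cubes. -/
theorem IsParentMap.exists_isDyadicSystem (hp : IsParentMap ρ A₀ c₀ C₀ δ z par)
    (hz : IsDyadicPoints ρ c₀ C₀ δ z) (hρ : IsQuasiMetric ρ A₀)
    (hd : GeometricallyDoubling ρ A₁) (hδ : 0 < δ) (hδ1 : δ < 1) (hc : 0 < c₀) (hcC : c₀ ≤ C₀)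
    (hsmall : 12 * A₀ ^ 3 * C₀ * δ ≤ c₀) :
    ∃ Q : ∀ k, A k → Set X, IsDyadicSystem ρ A₀ c₀ C₀ δ z par Q := by
  have hA := hρ.pos
  have hA1 := hρ.one_le
  have hC : 0 < C₀ := hc.trans_le hcC
  have h12 : 12 * A₀ ^ 3 * δ ≤ 1 := by
    have : (12 * A₀ ^ 3 * δ) * C₀ ≤ 1 * C₀ := by linarith
    exact le_of_mul_le_mul_right this hC
  have hA2 : A₀ ≤ A₀ ^ 2 := by nlinarith
  have hA3 : A₀ ^ 2 ≤ A₀ ^ 3 := by nlinarith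
  have h4 : 4 * A₀ ^ 2 * δ ≤ 1 := by nlinarith
  have h2 : 2 * A₀ * δ ≤ 1 := by nlinarith
  choose a hpar hmem using fun y => hp.exists_chain hz hρ hd hδ hδ1 hc hC h2 y
  -- Each point is assigned to the cubes of its own chosen chain, which makes partition and nesting
  -- automatic.
  let Q : ∀ k, A k → Set X := fun k α => {y | a y k = α}
  have hball : ∀ k α, qBall ρ (z k α) ((3 * A₀ ^ 2)⁻¹ * c₀ * δ ^ k) ⊆ Q k α := by
    intro k α y hy
    have h1 := hp.dist_lt_of_mem_closedCube hρ hδ hC h4 (hmem y (k + 1))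
    rw [hρ.symm] at h1
    have h3 : ρ (z (k + 1) (a y (k + 1))) (z k α) < (2 * A₀)⁻¹ * c₀ * δ ^ k := by
      refine hρ.lt_of_lt h1 hy ?_
      have hk : 0 < δ ^ k := zpow_pos hδ k
      rw [zpow_add_one₀ hδ.ne']
      have e1 : A₀ * (2 * A₀ * C₀ * (δ ^ k * δ) + (3 * A₀ ^ 2)⁻¹ * c₀ * δ ^ k) =
          (12 * A₀ ^ 3 * C₀ * δ + 2 * c₀) * (δ ^ k / (6 * A₀)) := by
        field_simp
        ring
      have e2 : (2 * A₀)⁻¹ * c₀ * δ ^ k = (3 * c₀) * (δ ^ k / (6 * A₀)) := by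
        field_simp
        ring
      rw [e1, e2]
      exact mul_le_mul_of_nonneg_right (by linarith) (by positivity)
    exact (hpar y k).symm.trans (hp.near k _ α h3)
  have hcenter : ∀ k α, z k α ∈ Q k α := fun k α =>
    hball k α (hρ.mem_qBall_self _ (by positivity))
  have hdesc : ∀ {p q : Σ k, A k}, DyadicLE par p q → Q p.1 p.2 ⊆ Q q.1 q.2 := by
    intro p q h
    induction h with
    | refl => exact subset_rfl
    | tail _ hbc ih =>
      obtain ⟨k, β, rfl, rfl⟩ := hbc
      intro y hy
      have := ih hy
      change a y k = par k β
      rw [← hpar y k]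
      exact congrArg _ this
  have hpre : ∀ k α, preCube z par k α ⊆ Q k α := by
    rintro k α _ ⟨ℓ, β, h, rfl⟩
    exact hdesc h (hcenter ℓ β)
  have hclosed : ∀ k α, Q k α ⊆ closedCube ρ z par k α := by
    rintro k α y rfl
    exact hmem y k
  have hopen : ∀ k α, openCube ρ z par k α ⊆ Q k α := by
    intro k α y hy
    by_contra hne
    exact hy (Set.mem_iUnion₂.2 ⟨a y k, hne, hmem y k⟩)
  have hdisj : ∀ k (α β : A k), α ≠ β → Disjoint (Q k α) (Q k β) := by
    intro k α β hne
    rw [Set.disjoint_left]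
    rintro y rfl hy
    exact hne hy
  have hdec : ∀ k ℓ (α : A k) (β : A ℓ), k ≤ ℓ →
      DyadicLE par ⟨ℓ, β⟩ ⟨k, α⟩ ∨ Q k α ∩ Q ℓ β = ∅ := by
    intro k ℓ α β hkℓ
    obtain ⟨α', hα'⟩ := exists_dyadicLE par hkℓ β
    by_cases h : α' = α
    · exact Or.inl (h ▸ hα')
    · refine Or.inr (Set.disjoint_iff_inter_eq_empty.1 ?_)
      exact (hdisj k α α' (Ne.symm h)).mono_right (hdesc hα')
  refine ⟨Q, hz, hp, hopen, hclosed, ?_, ?_, ?_, ?_, hdisj, hball, ?_, ?_⟩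
  · intro k α
    let _ := qTopology ρ
    refine Set.Subset.antisymm
      (interior_maximal (hopen k α) (hp.isOpen_openCube hz hρ hd hδ hc hC h4 k α)) ?_
    -- If `y` were also in another closed cube, the interior would meet that cube's preliminary
    -- cube, contradicting disjointness.
    intro y hy hy'
    obtain ⟨β, hne, hβ⟩ := Set.mem_iUnion₂.1 hy'
    obtain ⟨w, hw, hw'⟩ := mem_closure_iff.1 hβ _ isOpen_interior hy
    exact Set.disjoint_left.1 (hdisj k β α hne) (hpre k β hw') (interior_subset hw)
  · intro k α
    let _ := qTopology ρ
    exact Set.Subset.antisymm (closure_mono (hpre k α))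
      (closure_minimal (hclosed k α) isClosed_closure)
  · intro k ℓ α β hkℓ
    exact (hdec k ℓ α β hkℓ).imp_left fun h => hdesc h
  · intro k
    exact Set.eq_univ_of_forall fun y => Set.mem_iUnion.2 ⟨a y k, rfl⟩
  · intro k α y hy
    exact hp.dist_lt_of_mem_closedCube hρ hδ hC h4 (hclosed k α hy)
  · intro k ℓ α β hkℓ hsub y hy
    have hle : DyadicLE par ⟨ℓ, β⟩ ⟨k, α⟩ := by
      refine (hdec k ℓ α β hkℓ).resolve_right fun h => ?_
      have : z ℓ β ∈ Q k α ∩ Q ℓ β := ⟨hsub (hcenter ℓ β), hcenter ℓ β⟩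
      simp [h] at this
    rcases hle.eq_or_exists_child with h | ⟨σ, rfl, hσ⟩
    · cases h
      exact hy
    · have hk : 0 < C₀ * δ ^ k := by positivity
      have hlev : δ ^ ℓ ≤ δ ^ (k + 1) :=
        zpow_le_zpow_right_of_le_one₀ hδ hδ1.le hσ.level_le
      have hy' : ρ y (z ℓ β) < 2 * A₀ * C₀ * δ ^ (k + 1) :=
        lt_of_lt_of_le hy (by gcongr)
      have h1 := hρ.lt_of_lt hy' (hp.dist_lt_of_dyadicLE hρ hδ hC h2 hσ) le_rfl
      refine hρ.lt_of_lt h1 (hp.dist_lt k σ) ?_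
      dsimp only
      rw [zpow_add_one₀ hδ.ne']
      nlinarith [mul_le_mul_of_nonneg_left h4 (mul_pos hA hk).le]

end Cubes

/-! ### Colouring and moving the reference points -/

section RandomPoints

variable {X : Type u} {ρ : X → X → ℝ} {A₀ δ : ℝ} {A : ℤ → Type v} {x : ∀ k, A k → X}
  {par : ∀ k, A (k + 1) → A k} {A₁ : ℕ}

/-- Points can be coloured by boundedly many colours so that points of equal colour are far
apart. -/
theorem IsDyadicPoints.exists_coloring (hx : IsDyadicPoints ρ 1 1 δ x)
    (hρ : IsQuasiMetric ρ A₀) (hd : GeometricallyDoubling ρ A₁) (hδ : 0 < δ) {m : ℕ}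
    (hm : 4 * A₀ ^ 2 ≤ δ * 2 ^ m) (k : ℤ) :
    ∃ c : A (k + 1) → Fin (A₁ ^ m + 1), ∀ β β', β ≠ β' → c β = c β' →
      2 * A₀ * δ ^ k ≤ ρ (x (k + 1) β) (x (k + 1) β') := by
  have hA := hρ.pos
  have hk : 0 < δ ^ k := zpow_pos hδ k
  have hfin := fun β : A (k + 1) => hd.finite_and_ncard_le hρ (x (k + 1))
    (R := 2 * A₀ * δ ^ k) (m := m) (by positivity)
    (by rw [zpow_add_one₀ hδ.ne']; nlinarith) (hx.separated (k + 1)) (x (k + 1) β)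
  obtain ⟨c, hc⟩ := exists_coloring_of_ncard_le
    (fun β β' : A (k + 1) => ρ (x (k + 1) β') (x (k + 1) β) < 2 * A₀ * δ ^ k)
    (fun β β' h => by rwa [hρ.symm]) (A₁ ^ m) (fun β => (hfin β).1) (fun β => (hfin β).2)
  refine ⟨c, fun β β' hne hcc => ?_⟩
  by_contra! h
  exact hc β β' hne (by rwa [hρ.symm]) hcc

/-- Given a colouring of the children which is injective on siblings, the points `x k α` can be
replaced by their child of any prescribed colour, when there is one. -/
theorem exists_marked_points {K : Type*} (x : ∀ k, A k → X) (par : ∀ k, A (k + 1) → A k)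
    (col : ∀ k, A (k + 1) → K)
    (hcol : ∀ k β β', par k β = par k β' → col k β = col k β' → β = β') :
    ∃ w : ∀ k, A k → K → X,
      (∀ k α c, w k α c = x k α ∨ ∃ β, par k β = α ∧ col k β = c ∧ w k α c = x (k + 1) β) ∧
      ∀ k β, w k (par k β) (col k β) = x (k + 1) β := by
  have key : ∀ k (α : A k) (c : K), ∃ y : X,
      (y = x k α ∨ ∃ β, par k β = α ∧ col k β = c ∧ y = x (k + 1) β) ∧
      ∀ β, par k β = α → col k β = c → y = x (k + 1) β := by
    intro k α c
    by_cases h : ∃ β, par k β = α ∧ col k β = c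
    · obtain ⟨β, hβ, hβc⟩ := h
      refine ⟨x (k + 1) β, Or.inr ⟨β, hβ, hβc, rfl⟩, fun β' hβ' hβc' => ?_⟩
      rw [hcol k β β' (hβ.trans hβ'.symm) (hβc.trans hβc'.symm)]
    · exact ⟨x k α, Or.inl rfl, fun β hβ hβc => absurd ⟨β, hβ, hβc⟩ h⟩
  choose w hw hw' using key
  exact ⟨w, hw, fun k β => hw' k _ _ β rfl rfl⟩

/-- If every reference point either stays or moves to one of its children, and children to which
two different points of one generation move are far apart, the result is again a family of dyadic
points. -/
theorem IsParentMap.isDyadicPoints_of_children (hp : IsParentMap ρ A₀ 1 1 δ x par)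
    (hx : IsDyadicPoints ρ 1 1 δ x) (hρ : IsQuasiMetric ρ A₀) (hδ : 0 < δ)
    {K : Type*} (col : ∀ k, A (k + 1) → K) (κ : ℤ → K)
    (hcol : ∀ k β β', β ≠ β' → col k β = col k β' →
      2 * A₀ * δ ^ k ≤ ρ (x (k + 1) β) (x (k + 1) β')) {z : ∀ k, A k → X}
    (hz : ∀ k α, z k α = x k α ∨ ∃ β, par k β = α ∧ col k β = κ k ∧ z k α = x (k + 1) β) :
    IsDyadicPoints ρ (4 * A₀ ^ 2)⁻¹ (2 * A₀) δ z := by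
  have hA := hρ.pos
  have hA1 := hρ.one_le
  have hA2 : A₀ ≤ A₀ ^ 2 := by nlinarith
  have hinv1 : (4 * A₀ ^ 2)⁻¹ ≤ 1 := inv_le_one_of_one_le₀ (by linarith)
  have hinv2 : (4 * A₀ ^ 2)⁻¹ ≤ (2 * A₀)⁻¹ := inv_anti₀ (by positivity) (by linarith)
  constructor
  · intro k α α' hne
    have hk : 0 < δ ^ k := zpow_pos hδ k
    -- Contrapositive of `near`: a point this close to `α'` would be its child.
    have hmixed : ∀ β α', par k β ≠ α' →
        (4 * A₀ ^ 2)⁻¹ * δ ^ k ≤ ρ (x (k + 1) β) (x k α') := by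
      intro β α' h
      by_contra! hlt
      refine h (hp.near k β α' (hlt.trans_le ?_))
      rw [mul_one]
      gcongr
    rcases hz k α with h | ⟨β, hβ, hβc, h⟩ <;> rcases hz k α' with h' | ⟨β', hβ', hβc', h'⟩ <;>
      rw [h, h']
    · refine le_trans ?_ (hx.separated k α α' hne)
      gcongr
    · rw [hρ.symm]
      exact hmixed β' α fun h => hne (h.symm.trans hβ')
    · exact hmixed β α' fun h => hne (hβ.symm.trans h)
    · refine le_trans ?_ (hcol k β β' ?_ (hβc.trans hβc'.symm))
      · gcongr
        linarith
      · rintro rfl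
        exact hne (hβ.symm.trans hβ')
  · intro k y
    have hk : 0 < δ ^ k := zpow_pos hδ k
    obtain ⟨α, hα⟩ := hx.dense k y
    refine ⟨α, hρ.lt_of_lt hα (b := 1 * δ ^ k) ?_ (by linarith)⟩
    rcases hz k α with h | ⟨β, rfl, -, h⟩ <;> rw [h]
    · rw [hρ.self_eq_zero]
      linarith
    · rw [hρ.symm]
      exact hp.dist_lt k β

end RandomPoints

theorem exists_zpow_lt_le {δ r : ℝ} (hδ0 : 0 < δ) (hδ1 : δ < 1) (hr : 0 < r) :
    ∃ k : ℤ, δ ^ (k + 2) < r ∧ r ≤ δ ^ (k + 1) := by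
  obtain ⟨n, hn, hn'⟩ := exists_mem_Ioc_zpow hr ((one_lt_inv₀ hδ0).2 hδ1)
  refine ⟨-n - 2, ?_, ?_⟩
  · rwa [inv_zpow', show -n = -n - 2 + 2 by ring] at hn
  · rwa [inv_zpow', show -(n + 1) = -n - 2 + 1 by ring] at hn'

theorem theorem6p1 (A₀ δ : ℝ) (hA₀ : 1 ≤ A₀) (hδ0 : 0 < δ) (hδ1 : δ < 1)
    (hδ : 144 * A₀ ^ 8 * δ ≤ 1) :
    -- the constant of the covering property depends on `A₀` and `δ` only
    ∃ C : ℝ, ∀ A₁ : ℕ, 0 < A₁ →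
    -- the number of systems and the lower bound depend on `A₀`, `A₁` and `δ` only
    ∃ (K : ℕ) (τ₀ : ℝ), 0 < K ∧ 0 < τ₀ ∧
    ∀ (X : Type u) (ρ : X → X → ℝ), IsQuasiMetric ρ A₀ → GeometricallyDoubling ρ A₁ →
    -- the reference points and their partial order
    ∀ (A : ℤ → Type v) (x : ∀ k, A k → X), IsDyadicPoints ρ 1 1 δ x →
    ∀ par : ∀ k, A (k + 1) → A k, IsParentMap ρ A₀ 1 1 δ x par →
    -- the probability space is a product, and the new points of generation `k` are functions of
    -- the coordinate of index `k`
    ∃ (Ω : ℤ → Type) (_ : ∀ k, MeasurableSpace (Ω k)) (P : Measure (∀ k, Ω k))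
      (z : Fin K → ∀ k, A k → Ω k → X)
      (newPar : Fin K → (∀ k, Ω k) → ∀ k, A (k + 1) → A k)
      (Q : Fin K → (∀ k, Ω k) → ∀ k, A k → Set X),
      IsProbabilityMeasure P ∧
      -- the coordinates are independent
      iIndepFun (fun (k : ℤ) (ω : ∀ k, Ω k) => ω k) P ∧
      -- every `ω` and every `t` give a dyadic system
      (∀ (ω : ∀ k, Ω k) (t : Fin K),
        IsDyadicSystem ρ A₀ (4 * A₀ ^ 2)⁻¹ (2 * A₀) δ (fun k α => z t k α (ω k))
          (newPar t ω) (Q t ω)) ∧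
      -- for every `ω`, each ball is contained in a cube of comparable size of one of the systems
      (∀ (ω : ∀ k, Ω k) (y : X) (r : ℝ), 0 < r →
        ∃ (t : Fin K) (k : ℤ) (α : A k),
          qBall ρ y r ⊆ Q t ω k α ∧ qDiam ρ (Q t ω k α) ≤ ENNReal.ofReal (C * r)) ∧
      -- the new points are random points
      (∀ (t : Fin K) (k : ℤ) (α : A k) (y : X),
        MeasurableSet {ω : ∀ k, Ω k | z t k α (ω k) = y}) ∧
      -- every child of `(k, α)` is chosen with probability at least `τ₀`
      (∀ (t : Fin K) (k : ℤ) (α : A k) (β : A (k + 1)), par k β = α →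
        ENNReal.ofReal τ₀ ≤ P {ω : ∀ k, Ω k | z t k α (ω k) = x (k + 1) β}) := by
  have hA : 0 < A₀ := one_pos.trans_le hA₀
  have h6 : 144 * A₀ ^ 6 * δ ≤ 1 := by
    refine le_trans ?_ hδ
    gcongr
    norm_num
  have h5 : 144 * A₀ ^ 5 * δ ≤ 1 := by
    refine le_trans ?_ hδ
    gcongr
    norm_num
  -- The containing ball has radius `4 * A₀ ^ 2 * δ ^ k`, hence diameter at most `8 * A₀ ^ 3 * δ ^
  -- k`, and `δ ^ (k + 2) < r`.
  refine ⟨8 * A₀ ^ 3 * (δ ^ 2)⁻¹, fun A₁ _ => ?_⟩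
  obtain ⟨m, hm⟩ := pow_unbounded_of_one_lt (4 * A₀ ^ 2 / δ) one_lt_two
  rw [div_lt_iff₀' hδ0] at hm
  refine ⟨A₁ ^ m + 1, ((A₁ ^ m + 1 : ℕ) : ℝ)⁻¹, Nat.succ_pos _, by positivity, ?_⟩
  intro X ρ hρ hd A x hx par hp
  choose col hcol using fun k => hx.exists_coloring hρ hd hδ0 hm.le k
  have hsib : ∀ k β β', par k β = par k β' → col k β = col k β' → β = β' := by
    intro k β β' hpar hc
    by_contra hne
    refine (hcol k β β' hne hc).not_gt (hρ.lt_of_lt (b := 1 * δ ^ k) (hp.dist_lt k β) ?_ ?_)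
    · rw [hρ.symm, hpar]
      exact hp.dist_lt k β'
    · linarith
  obtain ⟨w, hw, hw'⟩ := exists_marked_points x par col hsib
  have hpts : ∀ κ : ℤ → Fin (A₁ ^ m + 1),
      IsDyadicPoints ρ (4 * A₀ ^ 2)⁻¹ (2 * A₀) δ fun k α => w k α (κ k) := fun κ =>
    hp.isDyadicPoints_of_children hx hρ hδ0 col κ hcol fun k α => hw k α (κ k)
  have hc0 : 0 < (4 * A₀ ^ 2)⁻¹ := by positivity
  have hcC : (4 * A₀ ^ 2)⁻¹ ≤ 2 * A₀ :=
    (inv_le_one_of_one_le₀ (by nlinarith)).trans (by linarith)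
  -- Parents and cubes may depend on the whole colour sequence `κ`; only the points are local in
  -- `k`.
  choose np hnp using fun κ => (hpts κ).exists_isParentMap hρ hδ0 hc0 hcC
  have hsmall : 12 * A₀ ^ 3 * (2 * A₀) * δ ≤ (4 * A₀ ^ 2)⁻¹ := by
    rw [le_inv_comm₀ (by positivity) (by positivity), le_inv_comm₀ (by positivity) (by positivity)]
    rw [← one_div, le_div_iff₀ (by positivity)]
    nlinarith
  choose D hD using fun κ =>
    (hnp κ).exists_isDyadicSystem (hpts κ) hρ hd hδ0 hδ1 hc0 hcC hsmall
  let μ : ℤ → Measure (Fin (A₁ ^ m + 1)) := fun _ =>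
    (PMF.uniformOfFintype (Fin (A₁ ^ m + 1))).toMeasure
  refine ⟨fun _ => Fin (A₁ ^ m + 1), fun _ => inferInstance, Measure.infinitePi μ,
    fun t k α c => w k α (c + t), fun t ω => np fun k => ω k + t, fun t ω => D fun k => ω k + t,
    inferInstance, ?_, fun ω t => hD fun k => ω k + t, ?_, ?_, ?_⟩
  · exact iIndepFun_infinitePi (P := μ) (X := fun _ c => c) fun _ => measurable_id
  · intro ω y r hr
    obtain ⟨k, hk, hk'⟩ := exists_zpow_lt_le hδ0 hδ1 hr
    obtain ⟨β, hβ⟩ := hx.dense (k + 1) y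
    have hδk : 0 < δ ^ k := zpow_pos hδ0 k
    -- The shift `t` is the one that makes generation `k` use the colour of `β`; the other
    -- generations play no role.
    have hsys := hD fun j => ω j + (col k β - ω k)
    have hcenter : w k (par k β) (ω k + (col k β - ω k)) = x (k + 1) β := by
      rw [add_sub_cancel, hw']
    refine ⟨col k β - ω k, k, par k β, ?_, ?_⟩
    · refine Set.Subset.trans (fun v hv => ?_) (hsys.ball_subset k (par k β))
      change ρ v (w k (par k β) (ω k + (col k β - ω k))) < _
      rw [hcenter]
      refine hρ.lt_of_lt (lt_of_lt_of_le hv hk') hβ ?_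
      rw [zpow_add_one₀ hδ0.ne']
      have e : (3 * A₀ ^ 2)⁻¹ * (4 * A₀ ^ 2)⁻¹ * δ ^ k = 1 * (δ ^ k / (12 * A₀ ^ 4)) := by
        field_simp
        norm_num
      have e' : A₀ * (δ ^ k * δ + 1 * (δ ^ k * δ)) =
          24 * A₀ ^ 5 * δ * (δ ^ k / (12 * A₀ ^ 4)) := by
        field_simp
        ring
      rw [e, e']
      refine mul_le_mul_of_nonneg_right ?_ (by positivity)
      have : 0 < A₀ ^ 5 * δ := by positivity
      linarith
    · refine iSup₂_le fun v hv => iSup₂_le fun v' hv' => ENNReal.ofReal_le_ofReal ?_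
      have h1 := hsys.subset_ball k (par k β) hv
      have h2 := hsys.subset_ball k (par k β) hv'
      refine (hρ.lt_of_lt h1 (b := 2 * A₀ * (2 * A₀) * δ ^ k) ?_ le_rfl).le.trans ?_
      · rw [hρ.symm]
        exact h2
      · rw [zpow_add₀ hδ0.ne'] at hk
        have hk2 : δ ^ k ≤ (δ ^ 2)⁻¹ * r := by
          rw [inv_mul_eq_div, le_div_iff₀ (by positivity)]
          exact hk.le
        calc A₀ * (2 * A₀ * (2 * A₀) * δ ^ k + 2 * A₀ * (2 * A₀) * δ ^ k)
            = 8 * A₀ ^ 3 * δ ^ k := by ring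
          _ ≤ 8 * A₀ ^ 3 * ((δ ^ 2)⁻¹ * r) := by gcongr
          _ = 8 * A₀ ^ 3 * (δ ^ 2)⁻¹ * r := by ring
  · intro t k α y
    exact (measurable_pi_apply (X := fun _ : ℤ => Fin (A₁ ^ m + 1)) k)
      (Set.toFinite {c : Fin (A₁ ^ m + 1) | w k α (c + t) = y}).measurableSet
  · rintro t k _ β rfl
    -- A single value of the uniform colour `ω k` already forces the move to `β`.
    have hsub : (fun ω : ℤ → Fin (A₁ ^ m + 1) => ω k) ⁻¹' {col k β - t} ⊆
        {ω | w k (par k β) (ω k + t) = x (k + 1) β} := by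
      intro ω hω
      have hω' : ω k = col k β - t := hω
      change w k (par k β) (ω k + t) = x (k + 1) β
      rw [hω', sub_add_cancel, hw']
    refine le_trans (le_of_eq ?_) (measure_mono hsub)
    rw [(measurePreserving_eval_infinitePi μ k).measure_preimage
      (measurableSet_singleton _).nullMeasurableSet]
    rw [PMF.toMeasure_apply_singleton _ _ (measurableSet_singleton _),
      PMF.uniformOfFintype_apply, Fintype.card_fin, ENNReal.ofReal_inv_of_pos (by positivity),
      ENNReal.ofReal_natCast]
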